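/- Let $\square$ be a category of cubes: a category with finite products and an object $I$ with two global points $0,1 : 1 \to I$, such that every object is a finite power of $I$. A cubical set is a presheaf of sets on $\square$. Let $\Delta : \mathbf{Set} \to \widehat{\square}$ be the constant presheaf functor and $\Gamma : \widehat{\square} \to \mathbf{Set}$, $\Gamma X = X(1)$, the global points functor, so $\Gamma\Delta Z \cong Z$. Fix a class of cofibrations $\varphi \hookrightarrow \mathbf{y}n$ into representables and a class of maps $r : n \to I$ in $\square$, both stable under reindexing along maps $m \to n$, such that $\emptyset \hookrightarrow \mathbf{y}n$ is always a cofibration and every global point $1 \to I$ belongs to the second class. A fibration (Kan fibration) is a map $f : X \to Y$ of cubical sets together with a choice of diagonal fillers, uniform in $n$, for all lifting problems of the open box inclusions $$(\varphi \times \mathbf{y}I) \cup \operatorname{graph}(r) \hookrightarrow \mathbf{y}n \times \mathbf{y}I$$ against $f$. A map $f : X \to Y$ is an h-proposition if the endpoint map $\operatorname{Path}_Y(X) \to X \times_Y X$ has a section, where $\operatorname{Path}_Y(X)$ is the pullback of $X^{\mathbf{y}I} \to Y^{\mathbf{y}I}$ along the constant path map $Y \to Y^{\mathbf{y}I}$.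 A propositional truncation of $f : X \to Y$ is a fibration $\|X\|_Y \to Y$ that is an h-proposition, with a map $X \to \|X\|_Y$ over $Y$, such that whenever $Q \to Y$ is a fibration and an h-proposition and there is a map $X \to Q$ over $Y$, there is a map $\|X\|_Y \to Q$ over $Y$. 1. Let $f : W \to \Delta Z$ be a fibration, where $Z$ is a set, and let $\|W\|_{\Delta Z} \to \Delta Z$ be a propositional truncation of $f$. If $\|W\|_{\Delta Z} \to \Delta Z$ has a section, then so does the map $\Gamma W \to \Gamma\Delta Z \cong Z$. 2. More generally, let $f : X \to Y$ be a fibration of cubical sets, and let $\|X\|_Y \to Y$ be a propositional truncation of $f$. If $\|X\|_Y \to Y$ has a section, then so does the map $\Gamma f : \Gamma X \to \Gamma Y$. -/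

import Mathlib

open CategoryTheory MonoidalCategory CartesianMonoidalCategory Opposite Limits

universe w v u

namespace CubicalSets

/-- A category of cubes: a category with (chosen) finite products and an object `interval`,
with two global points, such that every object is a finite power of `interval`. -/
class CubeCategory (C : Type u) [Category.{v} C] [CartesianMonoidalCategory C] where
  /-- the interval object `[1]` -/
  interval : C
  /-- the first endpoint of the interval -/
  zero : 𝟙_ C ⟶ interval
  /-- the second endpoint of the interval -/
  one : 𝟙_ C ⟶ interval
  /-- every object is an `n`-fold product of the interval -/
  exists_iso_power : ∀ c : C, ∃ n : ℕ,
    Nonempty (c ≅ Nat.rec (motive := fun _ => C) (𝟙_ C) (fun _ d => d ⊗ interval) n)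

/-- Cubical sets: presheaves on the category of cubes. -/
abbrev CSet (C : Type u) [Category.{v} C] : Type (max u v (w + 1)) := Cᵒᵖ ⥤ Type w

/-- The constant (discrete) cubical set functor `Δ`. -/
abbrev disc (C : Type u) [Category.{v} C] : Type w ⥤ CSet.{w} C := Functor.const Cᵒᵖ

/-- The global points functor `Γ`, which evaluates a cubical set at the terminal object `[0]`. -/
abbrev points (C : Type u) [Category.{v} C] [CartesianMonoidalCategory C] :
    CSet.{w} C ⥤ Type w :=
  (evaluation Cᵒᵖ (Type w)).obj (op (𝟙_ C))

/-- The canonical isomorphism `Γ Δ Z ≅ Z`. -/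
def pointsDiscIso (C : Type u) [Category.{v} C] [CartesianMonoidalCategory C] (Z : Type w) :
    (points.{w} C).obj ((disc.{w} C).obj Z) ≅ Z :=
  Iso.refl Z

section Cubes

variable {C : Type u} [Category.{v} C] [CartesianMonoidalCategory C] [CubeCategory C]

open CubeCategory (interval)

/-! ### Kan fibrations -/

/-- The data that fix which open boxes have to be filled: a class of cofibrations
`φ ↪ y n` into representables (a sieve on `n` is the same as a subpresheaf of `y n`) and a class
of generalised points `r : y n → y I` from which one fills; both are stable under reindexing,
`∅ ↪ y n` is a cofibration, and one can fill from every global point of the interval.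
Examples: `r` constant at an endpoint and `φ` in the face lattice (the cubical type theory of
Cohen, Coquand, Huber and Mörtberg); all `r` and a class of `φ` that contains the diagonals
(Cartesian cubical sets). -/
structure BoxSystem (C : Type u) [Category.{v} C] [CartesianMonoidalCategory C]
    [CubeCategory C] where
  cof : ∀ n : C, Set (Sieve n)
  cof_pullback : ∀ {m n : C} (s : m ⟶ n) {φ : Sieve n}, φ ∈ cof n → φ.pullback s ∈ cof m
  bot_mem_cof : ∀ n : C, (⊥ : Sieve n) ∈ cof n
  dir : ∀ n : C, Set (n ⟶ interval (C := C))
  dir_comp : ∀ {m n : C} (s : m ⟶ n) {r : n ⟶ interval}, r ∈ dir n → s ≫ r ∈ dir m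
  point_mem_dir : ∀ d : 𝟙_ C ⟶ interval, d ∈ dir (𝟙_ C)

/-- The open box `(φ × I) ∪ graph r` inside `y (n × I) = y n × y I`. -/
def openBox {n : C} (φ : Sieve n) (r : n ⟶ interval) : Sieve (n ⊗ interval) where
  arrows _ g := φ.arrows (g ≫ fst n interval) ∨ g ≫ snd n interval = g ≫ fst n interval ≫ r
  downward_closed := by
    rintro m m' g (hg | hg) h
    · left
      simpa using φ.downward_closed hg h
    · right
      simp [hg]

/-- Reindexing an open box along `s : m ⟶ n`. -/
theorem openBox_reindex {m n : C} (s : m ⟶ n) {φ : Sieve n} {r : n ⟶ interval} {k : C}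
    {g : k ⟶ m ⊗ interval} (hg : (openBox (φ.pullback s) (s ≫ r)).arrows g) :
    (openBox φ r).arrows (g ≫ s ▷ interval) := by
  rcases hg with hg | hg
  · left
    simpa [Sieve.pullback] using hg
  · right
    simpa using hg

variable (K : BoxSystem C)

/-- A lifting problem of an open box inclusion against `f`: a commutative square with top map
`x : openBox φ r → X` and bottom map `y : y (n × I) → Y`. By the Yoneda lemma, these are given as
a compatible family of elements of `X` and as an element of `Y` at `n × I`. -/
structure BoxProblem {X Y : CSet.{w} C} (f : X ⟶ Y) where
  n : C
  φ : Sieve n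
  φ_mem : φ ∈ K.cof n
  r : n ⟶ interval (C := C)
  r_mem : r ∈ K.dir n
  x : Presieve.FamilyOfElements X (openBox φ r).arrows
  x_compat : x.SieveCompatible
  y : Y.obj (op (n ⊗ interval))
  comm : ∀ ⦃k : C⦄ (g : k ⟶ n ⊗ interval) (hg : (openBox φ r).arrows g),
    f.app (op k) (x g hg) = Y.map g.op y

/-- Restriction of a lifting problem along a map `s : m ⟶ n` of cubes. -/
def BoxProblem.reindex {X Y : CSet.{w} C} {f : X ⟶ Y} (B : BoxProblem K f) {m : C}
    (s : m ⟶ B.n) : BoxProblem K f where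
  n := m
  φ := B.φ.pullback s
  φ_mem := K.cof_pullback s B.φ_mem
  r := s ≫ B.r
  r_mem := K.dir_comp s B.r_mem
  x _ g hg := B.x (g ≫ s ▷ interval) (openBox_reindex s hg)
  x_compat := by
    intro k k' g h hg
    have := B.x_compat (g ≫ s ▷ interval) h (openBox_reindex s hg)
    simpa only [Category.assoc] using this
  y := Y.map (s ▷ interval).op B.y
  comm := by
    intro k g hg
    have := B.comm (g ≫ s ▷ interval) (openBox_reindex s hg)
    simpa using this

/-- A Kan fibration structure on `f`: a choice of a diagonal filler for every lifting problem of
an open box against `f`, uniform in the sense that it commutes with reindexing. -/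
structure KanFibration {X Y : CSet.{w} C} (f : X ⟶ Y) where
  fill : ∀ B : BoxProblem K f, X.obj (op (B.n ⊗ interval))
  fill_extends : ∀ (B : BoxProblem K f), B.x.IsAmalgamation (fill B)
  fill_over : ∀ B : BoxProblem K f, f.app _ (fill B) = B.y
  uniform : ∀ (B : BoxProblem K f) {m : C} (s : m ⟶ B.n),
    fill (B.reindex K s) = X.map (s ▷ interval).op (fill B)

/-! ### Paths and homotopy propositions -/

/-- The path object functor `X ↦ X ^ I`. Since `I` is representable, `(X ^ I) n = X (n × I)`. -/
abbrev pathObj : CSet.{w} C ⥤ CSet.{w} C :=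
  (Functor.whiskeringLeft _ _ (Type w)).obj (tensorRight (interval (C := C))).op

/-- The constant path map `X → X ^ I`. -/
def constPath (X : CSet.{w} C) : X ⟶ pathObj.obj X where
  app n := X.map (fst n.unop interval).op
  naturality := by
    intro m n s
    dsimp
    rw [← X.map_comp, ← X.map_comp]
    congr 1
    apply Quiver.Hom.unop_inj
    simp

/-- Evaluation `X ^ I → X` of paths at a global point `d` of the interval. -/
def evalPath (d : 𝟙_ C ⟶ interval (C := C)) (X : CSet.{w} C) : pathObj.obj X ⟶ X where
  app n := X.map (lift (𝟙 n.unop) (toUnit n.unop ≫ d)).op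
  naturality := by
    intro m n s
    dsimp
    rw [← X.map_comp, ← X.map_comp]
    congr 1
    apply Quiver.Hom.unop_inj
    apply CartesianMonoidalCategory.hom_ext <;> simp

theorem constPath_naturality {X Y : CSet.{w} C} (f : X ⟶ Y) :
    f ≫ constPath Y = constPath X ≫ pathObj.map f := by
  ext n x
  simp [constPath]

theorem evalPath_naturality (d : 𝟙_ C ⟶ interval (C := C)) {X Y : CSet.{w} C} (f : X ⟶ Y) :
    pathObj.map f ≫ evalPath d Y = evalPath d X ≫ f := by
  ext n x
  simp [evalPath]

theorem constPath_evalPath (d : 𝟙_ C ⟶ interval (C := C)) (X : CSet.{w} C) :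
    constPath X ≫ evalPath d X = 𝟙 X := by
  ext n x
  dsimp [constPath, evalPath]
  rw [← ConcreteCategory.comp_apply, ← X.map_comp, ← op_comp]
  simp

/-- `Path_Y(X)`, the pullback of `X ^ I → Y ^ I` along the constant path map `Y → Y ^ I`. -/
noncomputable abbrev PathOver {X Y : CSet.{w} C} (f : X ⟶ Y) : CSet.{w} C :=
  pullback (pathObj.map f) (constPath Y)

/-- Evaluation of a path over `Y` at a point. -/
noncomputable def PathOver.eval (d : 𝟙_ C ⟶ interval (C := C)) {X Y : CSet.{w} C} (f : X ⟶ Y) :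
    PathOver f ⟶ X :=
  pullback.fst (pathObj.map f) (constPath Y) ≫ evalPath d X

theorem PathOver.eval_comp (d : 𝟙_ C ⟶ interval (C := C)) {X Y : CSet.{w} C} (f : X ⟶ Y) :
    PathOver.eval d f ≫ f = pullback.snd (pathObj.map f) (constPath Y) := by
  rw [PathOver.eval, Category.assoc, ← evalPath_naturality, pullback.condition_assoc,
    constPath_evalPath, Category.comp_id]

/-- The endpoint map `Path_Y(X) → X ×_Y X`. -/
noncomputable def pathEndpoints {X Y : CSet.{w} C} (f : X ⟶ Y) : PathOver f ⟶ pullback f f :=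
  pullback.lift (PathOver.eval CubeCategory.zero f) (PathOver.eval CubeCategory.one f)
    (by rw [PathOver.eval_comp, PathOver.eval_comp])

/-- `f : X ⟶ Y` is a homotopy proposition: `Path_Y(X) → X ×_Y X` has a section. -/
def IsHProp {X Y : CSet.{w} C} (f : X ⟶ Y) : Prop := IsSplitEpi (pathEndpoints f)

/-! ### Propositional truncation -/

/-- A propositional truncation of `f : X ⟶ Y` over `Y`: a Kan fibration `proj : obj ⟶ Y` that is
an h-proposition, with a map `X ⟶ obj` over `Y`, and such that every map over `Y` from `X` to an
h-proposition (which is a Kan fibration) `q : Q ⟶ Y` gives a map `obj ⟶ Q` over `Y`. (Such a map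
automatically extends the given one up to homotopy over `Y`, since `q` is an h-proposition.) -/
structure PropTrunc {X Y : CSet.{w} C} (f : X ⟶ Y) where
  obj : CSet.{w} C
  proj : obj ⟶ Y
  kan : KanFibration K proj
  isHProp : IsHProp proj
  unit : X ⟶ obj
  unit_proj : unit ≫ proj = f
  recursion : ∀ {Q : CSet.{w} C} (q : Q ⟶ Y), KanFibration K q → IsHProp q →
    ∀ g : X ⟶ Q, g ≫ q = f → ∃ h : obj ⟶ Q, h ≫ q = proj

end Cubes

end CubicalSets

namespace CubicalSets

section Points

variable {C : Type u} [Category.{v} C] [CartesianMonoidalCategory C]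

/-- The subobject of `Y` of all cubes whose vertices lie in the image of `f` on global points. -/
def pointwiseImage {X Y : CSet.{w} C} (f : X ⟶ Y) : Subfunctor Y where
  obj n := {y | ∀ p : 𝟙_ C ⟶ n.unop, ∃ x : X.obj (op (𝟙_ C)), f.app _ x = Y.map p.op y}
  map {m n} s y hy p := by
    obtain ⟨x, hx⟩ := hy (p ≫ s.unop)
    refine ⟨x, hx.trans ?_⟩
    rw [op_comp, Y.map_comp, ConcreteCategory.comp_apply, Quiver.Hom.op_unop]

theorem range_le_pointwiseImage {X Y : CSet.{w} C} (f : X ⟶ Y) :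
    Subfunctor.range f ≤ pointwiseImage f := by
  rintro n _ ⟨x, rfl⟩ p
  exact ⟨X.map p.op x, NatTrans.naturality_apply f p.op x⟩

end Points

section Cubes

variable {C : Type u} [Category.{v} C] [CartesianMonoidalCategory C] [CubeCategory C]

open CubeCategory (interval)

/-- Every monomorphism is a homotopy proposition, by constant paths. -/
theorem isHProp_of_mono {X Y : CSet.{w} C} (f : X ⟶ Y) [Mono f] : IsHProp f := by
  have diag : pullback.fst f f = pullback.snd f f := by
    rw [← cancel_mono f, pullback.condition]
  refine IsSplitEpi.mk' ⟨pullback.lift (pullback.fst f f ≫ constPath X) (pullback.fst f f ≫ f)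
    (by rw [Category.assoc, Category.assoc, constPath_naturality]), ?_⟩
  have eval (d : 𝟙_ C ⟶ interval (C := C)) :
      pullback.lift (pullback.fst f f ≫ constPath X) (pullback.fst f f ≫ f)
        (by rw [Category.assoc, Category.assoc, constPath_naturality]) ≫ PathOver.eval d f =
        pullback.fst f f := by
    rw [PathOver.eval, pullback.lift_fst_assoc, Category.assoc, constPath_evalPath,
      Category.comp_id]
  apply pullback.hom_ext
  · rw [Category.assoc, pathEndpoints, pullback.lift_fst, Category.id_comp]
    exact eval _
  · rw [Category.assoc, pathEndpoints, pullback.lift_snd, Category.id_comp, ← diag]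
    exact eval _

/-- Transport in a Kan fibration between global points: along a path in the base that starts at a
point with a lift, every point has a lift. -/
theorem KanFibration.exists_lift_of_path {K : BoxSystem C} {X Y : CSet.{w} C} {f : X ⟶ Y}
    (F : KanFibration K f) (y : Y.obj (op (𝟙_ C ⊗ interval))) (g g' : 𝟙_ C ⟶ 𝟙_ C ⊗ interval)
    (x : X.obj (op (𝟙_ C))) (hx : f.app _ x = Y.map g.op y) :
    ∃ x' : X.obj (op (𝟙_ C)), f.app _ x' = Y.map g'.op y := by
  let B : BoxProblem K f :=
    { n := 𝟙_ C
      φ := ⊥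
      φ_mem := K.bot_mem_cof _
      r := g ≫ snd _ _
      r_mem := K.point_mem_dir _
      x := fun k _ _ => X.map (toUnit k).op x
      x_compat := by
        intro k k' h s _
        rw [← ConcreteCategory.comp_apply, ← X.map_comp, ← op_comp]
        exact congrArg (fun t : k' ⟶ 𝟙_ C => X.map t.op x) (toUnit_unique _ _)
      y := y
      comm := by
        rintro k h (hh | hh)
        · exact hh.elim
        · have : h = toUnit k ≫ g := by
            apply CartesianMonoidalCategory.hom_ext
            · exact toUnit_unique _ _
            · rw [hh, Category.assoc, ← Category.assoc, toUnit_unique (h ≫ fst _ _) (toUnit k)]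
          rw [NatTrans.naturality_apply, hx, this, op_comp, Y.map_comp,
            ConcreteCategory.comp_apply] }
  refine ⟨X.map g'.op (F.fill B), ?_⟩
  rw [NatTrans.naturality_apply, F.fill_over B]

/-- The base cube of an open box in the pointwise image of a Kan fibration again lies in it: each
of its vertices is joined by an edge to the part of the box on the graph. -/
theorem KanFibration.boxProblem_mem_pointwiseImage {K : BoxSystem C} {X Y : CSet.{w} C}
    {f : X ⟶ Y} (F : KanFibration K f) (B : BoxProblem K (pointwiseImage f).ι) :
    B.y ∈ (pointwiseImage f).obj (op (B.n ⊗ interval)) := by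
  intro p
  let q : 𝟙_ C ⟶ B.n := p ≫ fst _ _
  have hq : (openBox B.φ B.r).arrows (lift q (q ≫ B.r)) := Or.inr (by simp)
  obtain ⟨x, hx⟩ := (B.x _ hq).2 (𝟙 _)
  have hB : (B.x _ hq).1 = Y.map (lift q (q ≫ B.r)).op B.y := B.comm _ hq
  obtain ⟨x', hx'⟩ := F.exists_lift_of_path (Y.map (q ▷ interval).op B.y)
    (lift (𝟙 _) (q ≫ B.r)) (lift (𝟙 _) (p ≫ snd _ _)) x (by
      rw [hx, hB, ← ConcreteCategory.comp_apply, ← ConcreteCategory.comp_apply, ← Y.map_comp,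
        ← Y.map_comp, ← op_comp, ← op_comp]
      simp)
  refine ⟨x', hx'.trans ?_⟩
  rw [← ConcreteCategory.comp_apply, ← Y.map_comp, ← op_comp]
  congr 4
  apply CartesianMonoidalCategory.hom_ext <;> simp [q]

/-- The inclusion of the pointwise image of a Kan fibration is a Kan fibration. -/
def KanFibration.pointwiseImage {K : BoxSystem C} {X Y : CSet.{w} C} {f : X ⟶ Y}
    (F : KanFibration K f) : KanFibration K (pointwiseImage f).ι where
  fill B := ⟨B.y, F.boxProblem_mem_pointwiseImage B⟩
  fill_extends B _ g hg := Subtype.ext (B.comm g hg).symm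
  fill_over _ := rfl
  uniform _ _ _ := rfl

/-- If a propositional truncation of a Kan fibration has a section, then the fibration is
surjective on global points. -/
theorem PropTrunc.surjective_points {K : BoxSystem C} {X Y : CSet.{w} C} {f : X ⟶ Y}
    (F : KanFibration K f) (T : PropTrunc K f) (hT : IsSplitEpi T.proj) :
    Function.Surjective ((points.{w} C).map f) := by
  obtain ⟨h, hh⟩ := T.recursion (pointwiseImage f).ι F.pointwiseImage (isHProp_of_mono _)
    (Subfunctor.lift f (range_le_pointwiseImage f)) (Subfunctor.lift_ι _ _)
  intro y
  have hs : section_ T.proj ≫ h ≫ (pointwiseImage f).ι = 𝟙 Y := by rw [hh, IsSplitEpi.id]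
  obtain ⟨x, hx⟩ := ((section_ T.proj ≫ h).app (op (𝟙_ C)) y).2 (𝟙 _)
  refine ⟨x, hx.trans ?_⟩
  rw [op_id, Y.map_id]
  exact congrArg (fun t : Y ⟶ Y => t.app (op (𝟙_ C)) y) hs

end Cubes

end CubicalSets

theorem mainTheorem8 {C : Type u} [Category.{v} C] [CartesianMonoidalCategory C]
    [CubicalSets.CubeCategory C] (K : CubicalSets.BoxSystem C) :
    (∀ (Z : Type w) (W : CubicalSets.CSet.{w} C) (f : W ⟶ (CubicalSets.disc.{w} C).obj Z)
        (_ : CubicalSets.KanFibration K f) (T : CubicalSets.PropTrunc K f),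
        IsSplitEpi T.proj →
        IsSplitEpi ((CubicalSets.points.{w} C).map f ≫
          (CubicalSets.pointsDiscIso.{w} C Z).hom)) ∧
    (∀ (X Y : CubicalSets.CSet.{w} C) (f : X ⟶ Y)
        (_ : CubicalSets.KanFibration K f) (T : CubicalSets.PropTrunc K f),
        IsSplitEpi T.proj →
        IsSplitEpi ((CubicalSets.points.{w} C).map f)) := by
  have main (X Y : CubicalSets.CSet.{w} C) (f : X ⟶ Y) (F : CubicalSets.KanFibration K f)
      (T : CubicalSets.PropTrunc K f) (hT : IsSplitEpi T.proj) :
      IsSplitEpi ((CubicalSets.points.{w} C).map f) :=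
    (isSplitEpi_iff_surjective _).2 (T.surjective_points F hT)
  refine ⟨fun Z W f F T hT => ?_, main⟩
  have := main _ _ f F T hT
  infer_instance
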